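/- Let $n\ge 1$, $s\in(0,1)$, let $\Omega\subset\mathbb{R}^n$ be nonempty, open and bounded, $\Omega^c=\mathbb{R}^n\setminus\Omega$, and let $\beta\in L^\infty(\Omega^c)$ with $\beta\ge 0$ a.e. Let $G(t)=\int_0^t g(\tau)\,d\tau$ be a Young function, i.e. $g:[0,\infty)\to[0,\infty)$ is right continuous, $g(0)=0$, $g>0$ and non-decreasing on $(0,\infty)$, $g(t)\to\infty$ as $t\to\infty$, and assume $1<p^-\le \frac{t g(t)}{G(t)}\le p^+<\infty$ for all $t>0$. Write $$D_su(x,y)=\frac{u(x)-u(y)}{|x-y|^s},\qquad d\mu=\frac{dx\,dy}{|x-y|^n},\qquad Q=\mathbb{R}^{2n}\setminus(\Omega^c\times\Omega^c),$$ and $g(|t|)\frac{t}{|t|}:=0$ for $t=0$. For measurable $u:\mathbb{R}^n\to\mathbb{R}$ put $\mathcal I(u)=\int_\Omega G(|u|)\,dx$, $\mathcal J(u)=\iint_{\mathbb{R}^{2n}}G(|D_su|)\,d\mu$, $\mathcal J_0(u)=\iint_Q G(|D_su|)\,d\mu$, $\mathcal J_\beta(u)=\mathcal J_0(u)+\int_{\Omega^c}\beta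 G(|u|)\,dx$, and consider the spaces (functions being identified a.e. on $\mathbb{R}^n$) $$X^D=\Big\{u:\ \int_{\mathbb{R}^n}G(|u|)\,dx+\mathcal J(u)<\infty,\ u=0\text{ a.e. in }\Omega^c\Big\},\quad X^N=\{u:\ \mathcal I(u)+\mathcal J_0(u)<\infty\},\quad X^R=\{u:\ \mathcal I(u)+\mathcal J_\beta(u)<\infty\}.$$ For $u,v$ in the respective space set $$a^D(u,v)=\iint_{\mathbb{R}^{2n}}g(|D_su|)\frac{D_su}{|D_su|}D_sv\,d\mu,\qquad a^N(u,v)=\iint_{Q}g(|D_su|)\frac{D_su}{|D_su|}D_sv\,d\mu,$$ $$a^R(u,v)=a^N(u,v)+\int_{\Omega^c}\beta g(|u|)\frac{u}{|u|}v\,dx .$$ For $*\in\{D,N,R\}$ (the Dirichlet, Neumann and Robin problems for the fractional $g$-Laplacian), a real number $\lambda$ is an eigenvalue of problem $*$ with eigenfunction $u\in X^*\setminus\{0\}$ if $a^*(u,v)=\lambda\int_\Omega g(|u|)\frac{u}{|u|}v\,dx$ for all $v\in X^*$. For $\alpha>0$, a Lagrange-multiplier eigenvalue $\lambda^*_\alpha$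 at level $\alpha$ is an eigenvalue of problem $*$ having an eigenfunction that minimizes $\mathcal J$ (if $*=D$), $\mathcal J_0$ (if $*=N$), $\mathcal J_\beta$ (if $*=R$) over $\{u\in X^*:\mathcal I(u)=\alpha\}$. For $\alpha_0>0$ let $$\hat\lambda^*=\inf\{\lambda^*_\alpha:\ \alpha\in(0,\alpha_0)\},\qquad \bar\lambda^*=\inf_{u\in X^*\setminus\{0\}}\frac{a^*(u,u)}{\int_\Omega g(|u|)|u|\,dx},$$ the first infimum being over all Lagrange-multiplier eigenvalues at levels in $(0,\alpha_0)$ (with $\inf\emptyset=+\infty$), and quotients with zero denominator and positive numerator being $+\infty$. Theorem. For every $\alpha_0>0$ and each $*\in\{D,N,R\}$, $$\bar\lambda^*\le\hat\lambda^*,$$ and problem $*$ has no eigenvalue $\lambda$ with $\lambda<\bar\lambda^*$. -/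

import Mathlib

open MeasureTheory Set
open scoped ENNReal

noncomputable section

namespace GLap

/-- The space `ℝⁿ` with its Euclidean norm and Lebesgue measure. -/
abbrev Rn (n : ℕ) : Type := EuclideanSpace ℝ (Fin n)

/-- The primitive `G(t) = ∫₀ᵗ g(τ) dτ`. -/
def primitive (g : ℝ → ℝ) (t : ℝ) : ℝ := ∫ τ in (0 : ℝ)..t, g τ

/-- `g` is the density of a Young function `G = primitive g` (only the values of `g` on `[0,∞)`
matter). -/
structure IsYoungDensity (g : ℝ → ℝ) : Prop where
  zero : g 0 = 0
  pos : ∀ t : ℝ, 0 < t → 0 < g t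
  rightCont : ∀ t : ℝ, 0 ≤ t → ContinuousWithinAt g (Ici t) t
  mono : MonotoneOn g (Ioi 0)
  tendsto : Filter.Tendsto g Filter.atTop Filter.atTop

/-- The growth condition `1 < p⁻ ≤ t g(t) / G(t) ≤ p⁺ < ∞` for all `t > 0`. -/
def GrowthCondition (g : ℝ → ℝ) (pminus pplus : ℝ) : Prop :=
  1 < pminus ∧
    ∀ t : ℝ, 0 < t → pminus ≤ t * g t / primitive g t ∧ t * g t / primitive g t ≤ pplus

/-- The odd function `t ↦ g(|t|) t / |t|`, with value `0` at `t = 0`. -/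
def oddg (g : ℝ → ℝ) (t : ℝ) : ℝ := g |t| * (t / |t|)

variable {n : ℕ}

/-- The `s`-Hölder quotient `D_s u (x, y) = (u(x) - u(y)) / |x - y|^s`. -/
def Ds (s : ℝ) (u : Rn n → ℝ) (z : Rn n × Rn n) : ℝ := (u z.1 - u z.2) / ‖z.1 - z.2‖ ^ s

/-- The measure `dμ(x, y) = dx dy / |x - y|ⁿ` on `ℝⁿ × ℝⁿ` (for `n ≥ 1` the diagonal is null, so
the value of the density there is immaterial). -/
def mu (n : ℕ) : Measure (Rn n × Rn n) :=
  (volume : Measure (Rn n × Rn n)).withDensity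
    fun z => ENNReal.ofReal (1 / ‖z.1 - z.2‖ ^ n)

/-- The region `ℝ²ⁿ \ (Ωᶜ × Ωᶜ)`. -/
def crossRegion (Ω : Set (Rn n)) : Set (Rn n × Rn n) := (Ωᶜ ×ˢ Ωᶜ)ᶜ

/-! ### Modulars (as extended nonnegative numbers) -/

/-- `Φ_{G,A}(u) = ∫_A G(|u|) dx`. -/
def modular (g : ℝ → ℝ) (A : Set (Rn n)) (u : Rn n → ℝ) : ℝ≥0∞ :=
  ∫⁻ x in A, ENNReal.ofReal (primitive g |u x|)

/-- `∬_R G(|D_s u|) dμ`. -/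
def modularDs (g : ℝ → ℝ) (s : ℝ) (R : Set (Rn n × Rn n)) (u : Rn n → ℝ) : ℝ≥0∞ :=
  ∫⁻ z in R, ENNReal.ofReal (primitive g |Ds s u z|) ∂(mu n)

/-- `Φ_{G,β,Ωᶜ}(u) = ∫_{Ωᶜ} β G(|u|) dx`, for `β ≥ 0`. -/
def modularBdry (g : ℝ → ℝ) (Ω : Set (Rn n)) (β : Rn n → ℝ) (u : Rn n → ℝ) : ℝ≥0∞ :=
  ∫⁻ x in Ωᶜ, ENNReal.ofReal (β x * primitive g |u x|)

/-! ### The function spaces -/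

/-- `W^{s,G}_0(Ω)`. -/
def dirichletSpace (g : ℝ → ℝ) (s : ℝ) (Ω : Set (Rn n)) : Set (Rn n → ℝ) :=
  {u | AEMeasurable u volume ∧ modular g univ u < ∞ ∧ modularDs g s univ u < ∞ ∧
    ∀ᵐ x ∂(volume.restrict Ωᶜ), u x = 0}

/-- `W^{s,G}_*(Ω)`. -/
def neumannSpace (g : ℝ → ℝ) (s : ℝ) (Ω : Set (Rn n)) : Set (Rn n → ℝ) :=
  {u | AEMeasurable u volume ∧ modular g Ω u < ∞ ∧ modularDs g s (crossRegion Ω) u < ∞}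

/-- `𝒳_β(Ω)`. -/
def robinSpace (g : ℝ → ℝ) (s : ℝ) (Ω : Set (Rn n)) (β : Rn n → ℝ) : Set (Rn n → ℝ) :=
  {u | AEMeasurable u volume ∧ modular g Ω u < ∞ ∧ modularDs g s (crossRegion Ω) u < ∞ ∧
    modularBdry g Ω β u < ∞}

/-! ### Weak formulation -/

/-- The pairing `∬_R g(|D_s u|) (D_s u / |D_s u|) D_s v dμ`. For `R = univ` this is
`⟨(-Δ_g)^s u, v⟩`, for `R = crossRegion Ω` it is `⟨(-Δ_g)^s u, v⟩_*`. -/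
def pairing (g : ℝ → ℝ) (s : ℝ) (R : Set (Rn n × Rn n)) (u v : Rn n → ℝ) : ℝ :=
  ∫ z in R, oddg g (Ds s u z) * Ds s v z ∂(mu n)

/-- `∫_Ω g(|u|) (u / |u|) v dx`. -/
def pairingDomain (g : ℝ → ℝ) (Ω : Set (Rn n)) (u v : Rn n → ℝ) : ℝ :=
  ∫ x in Ω, oddg g (u x) * v x

/-- `∫_{Ωᶜ} β g(|u|) (u / |u|) v dx`. -/
def pairingBdry (g : ℝ → ℝ) (Ω : Set (Rn n)) (β : Rn n → ℝ) (u v : Rn n → ℝ) : ℝ :=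
  ∫ x in Ωᶜ, β x * oddg g (u x) * v x

/-- `u` is a (nontrivial) eigenfunction of the Dirichlet problem with eigenvalue `lam`. -/
def IsDirichletEigenpair (g : ℝ → ℝ) (s : ℝ) (Ω : Set (Rn n)) (lam : ℝ) (u : Rn n → ℝ) : Prop :=
  u ∈ dirichletSpace g s Ω ∧ ¬ u =ᵐ[volume] 0 ∧
    ∀ v ∈ dirichletSpace g s Ω, pairing g s univ u v = lam * pairingDomain g Ω u v

/-- `u` is a (nontrivial) eigenfunction of the Neumann problem with eigenvalue `lam`. -/
def IsNeumannEigenpair (g : ℝ → ℝ) (s : ℝ) (Ω : Set (Rn n)) (lam : ℝ) (u : Rn n → ℝ) : Prop :=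
  u ∈ neumannSpace g s Ω ∧ ¬ u =ᵐ[volume] 0 ∧
    ∀ v ∈ neumannSpace g s Ω, pairing g s (crossRegion Ω) u v = lam * pairingDomain g Ω u v

/-- `u` is a (nontrivial) eigenfunction of the Robin problem with eigenvalue `lam`. -/
def IsRobinEigenpair (g : ℝ → ℝ) (s : ℝ) (Ω : Set (Rn n)) (β : Rn n → ℝ) (lam : ℝ)
    (u : Rn n → ℝ) : Prop :=
  u ∈ robinSpace g s Ω β ∧ ¬ u =ᵐ[volume] 0 ∧
    ∀ v ∈ robinSpace g s Ω β,
      pairing g s (crossRegion Ω) u v = lam * pairingDomain g Ω u v - pairingBdry g Ω β u v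

/-- `lam` is an eigenvalue of the Dirichlet problem. -/
def IsDirichletEigenvalue (g : ℝ → ℝ) (s : ℝ) (Ω : Set (Rn n)) (lam : ℝ) : Prop :=
  ∃ u, IsDirichletEigenpair g s Ω lam u

/-- `lam` is an eigenvalue of the Neumann problem. -/
def IsNeumannEigenvalue (g : ℝ → ℝ) (s : ℝ) (Ω : Set (Rn n)) (lam : ℝ) : Prop :=
  ∃ u, IsNeumannEigenpair g s Ω lam u

/-- `lam` is an eigenvalue of the Robin problem. -/
def IsRobinEigenvalue (g : ℝ → ℝ) (s : ℝ) (Ω : Set (Rn n)) (β : Rn n → ℝ) (lam : ℝ) : Prop :=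
  ∃ u, IsRobinEigenpair g s Ω β lam u

/-! ### Lagrange-multiplier eigenvalues -/

/-- `u` minimizes `J` over the functions of the class `X` with `∫_Ω G(|u|) dx = α`. -/
def IsConstrainedMin (g : ℝ → ℝ) (Ω : Set (Rn n)) (X : Set (Rn n → ℝ))
    (J : (Rn n → ℝ) → ℝ≥0∞) (α : ℝ) (u : Rn n → ℝ) : Prop :=
  (u ∈ X ∧ modular g Ω u = ENNReal.ofReal α) ∧
    ∀ v ∈ X, modular g Ω v = ENNReal.ofReal α → J u ≤ J v

/-- `lam` is a value of `λ_α^D`: an eigenvalue of the Dirichlet problem with an eigenfunction that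
minimizes `𝒥` at energy level `α`. -/
def IsDirichletMultiplier (g : ℝ → ℝ) (s : ℝ) (Ω : Set (Rn n)) (α lam : ℝ) : Prop :=
  ∃ u, IsConstrainedMin g Ω (dirichletSpace g s Ω) (modularDs g s univ) α u ∧
    IsDirichletEigenpair g s Ω lam u

/-- `lam` is a value of `λ_α^N`: an eigenvalue of the Neumann problem with an eigenfunction that
minimizes `𝒥₀` at energy level `α`. -/
def IsNeumannMultiplier (g : ℝ → ℝ) (s : ℝ) (Ω : Set (Rn n)) (α lam : ℝ) : Prop :=
  ∃ u, IsConstrainedMin g Ω (neumannSpace g s Ω) (modularDs g s (crossRegion Ω)) α u ∧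
    IsNeumannEigenpair g s Ω lam u

/-- `lam` is a value of `λ_α^R`: an eigenvalue of the Robin problem with an eigenfunction that
minimizes `𝒥_β` at energy level `α`. -/
def IsRobinMultiplier (g : ℝ → ℝ) (s : ℝ) (Ω : Set (Rn n)) (β : Rn n → ℝ) (α lam : ℝ) : Prop :=
  ∃ u, IsConstrainedMin g Ω (robinSpace g s Ω β)
      (fun w => modularDs g s (crossRegion Ω) w + modularBdry g Ω β w) α u ∧
    IsRobinEigenpair g s Ω β lam u

/-- The infimum of all multipliers `λ_α`, `α ∈ (0, α₀)`, in the extended reals. Minimizers need not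
be unique; the infimum runs over all of them, hence is at most the infimum of any selection
`α ↦ λ_α`. -/
def hatInf (M : ℝ → ℝ → Prop) (α₀ : ℝ) : EReal :=
  ⨅ (α : ℝ) (_ : α ∈ Ioo 0 α₀) (lam : ℝ) (_ : M α lam), (lam : EReal)

/-- `\hat λ^D`. -/
def hatD (g : ℝ → ℝ) (s : ℝ) (Ω : Set (Rn n)) (α₀ : ℝ) : EReal :=
  hatInf (IsDirichletMultiplier g s Ω) α₀

/-- `\hat λ^N`. -/
def hatN (g : ℝ → ℝ) (s : ℝ) (Ω : Set (Rn n)) (α₀ : ℝ) : EReal :=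
  hatInf (IsNeumannMultiplier g s Ω) α₀

/-- `\hat λ^R`. -/
def hatR (g : ℝ → ℝ) (s : ℝ) (Ω : Set (Rn n)) (β : Rn n → ℝ) (α₀ : ℝ) : EReal :=
  hatInf (IsRobinMultiplier g s Ω β) α₀

/-! ### Rayleigh-type infima

The quotients are taken in `[0,∞]`, where `a / 0 = ∞` for `a > 0`: in the Neumann and Robin cases
a nontrivial function that vanishes in `Ω` has a positive numerator and does not affect the
infimum. -/

/-- `∬_R g(|D_s u|) |D_s u| dμ`. -/
def energy (g : ℝ → ℝ) (s : ℝ) (R : Set (Rn n × Rn n)) (u : Rn n → ℝ) : ℝ≥0∞ :=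
  ∫⁻ z in R, ENNReal.ofReal (g |Ds s u z| * |Ds s u z|) ∂(mu n)

/-- `∫_Ω g(|u|) |u| dx`. -/
def energyDomain (g : ℝ → ℝ) (Ω : Set (Rn n)) (u : Rn n → ℝ) : ℝ≥0∞ :=
  ∫⁻ x in Ω, ENNReal.ofReal (g |u x| * |u x|)

/-- `∫_{Ωᶜ} β g(|u|) |u| dx`, for `β ≥ 0`. -/
def energyBdry (g : ℝ → ℝ) (Ω : Set (Rn n)) (β : Rn n → ℝ) (u : Rn n → ℝ) : ℝ≥0∞ :=
  ∫⁻ x in Ωᶜ, ENNReal.ofReal (β x * (g |u x| * |u x|))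

/-- `\bar λ^D`. -/
def barD (g : ℝ → ℝ) (s : ℝ) (Ω : Set (Rn n)) : ℝ≥0∞ :=
  ⨅ (u : Rn n → ℝ) (_ : u ∈ dirichletSpace g s Ω ∧ ¬ u =ᵐ[volume] 0),
    energy g s univ u / energyDomain g Ω u

/-- `\bar λ^N`. -/
def barN (g : ℝ → ℝ) (s : ℝ) (Ω : Set (Rn n)) : ℝ≥0∞ :=
  ⨅ (u : Rn n → ℝ) (_ : u ∈ neumannSpace g s Ω ∧ ¬ u =ᵐ[volume] 0),
    energy g s (crossRegion Ω) u / energyDomain g Ω u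

/-- `\bar λ^R`. -/
def barR (g : ℝ → ℝ) (s : ℝ) (Ω : Set (Rn n)) (β : Rn n → ℝ) : ℝ≥0∞ :=
  ⨅ (u : Rn n → ℝ) (_ : u ∈ robinSpace g s Ω β ∧ ¬ u =ᵐ[volume] 0),
    (energy g s (crossRegion Ω) u + energyBdry g Ω β u) / energyDomain g Ω u

end GLap

end

/-! Testing the weak equation with the eigenfunction itself gives `a(u,u) = λ ∫_Ω g(|u|)|u|`,
because `oddg g t * t = g |t| * |t|`. So every eigenvalue is the Rayleigh quotient of its
eigenfunction and is at least the infimum of all quotients. This excludes eigenvalues below that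
infimum, and it also bounds `hatInf`, since a multiplier is in particular an eigenvalue.

Two points need care. The bound `t g(t) ≤ p⁺ G(t)` makes all the energies finite, so the real-valued
pairings carry the same information as the `ℝ≥0∞` quotients. The denominator must also be nonzero:
if it vanished, the equation would make the numerator vanish too, and `ae_eq_zero_of_energy_eq_zero`
would give `u = 0`. -/

namespace GLap

variable {n : ℕ} {g : ℝ → ℝ} {pminus pplus : ℝ} {s : ℝ} {Ω : Set (Rn n)} {β u : Rn n → ℝ}

/-! ### The density `g` and its growth -/

theorem IsYoungDensity.nonneg (hg : IsYoungDensity g) {t : ℝ} (ht : 0 ≤ t) : 0 ≤ g t := by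
  rcases ht.eq_or_lt with rfl | h
  · exact hg.zero.ge
  · exact (hg.pos t h).le

theorem IsYoungDensity.nonneg_abs_mul (hg : IsYoungDensity g) (t : ℝ) : 0 ≤ g |t| * |t| :=
  mul_nonneg (hg.nonneg (abs_nonneg t)) (abs_nonneg t)

theorem IsYoungDensity.eq_zero_of_abs_mul_le (hg : IsYoungDensity g) {t : ℝ}
    (h : g |t| * |t| ≤ 0) : t = 0 := by
  by_contra ht
  exact absurd h (not_le.2 (mul_pos (hg.pos _ (abs_pos.2 ht)) (abs_pos.2 ht)))

/-- Nothing is known about `g` on the negative axis, so `g` is replaced by `t ↦ g (max t 0)`, which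
is monotone on the whole line and agrees with `g` at `|t|`. -/
theorem IsYoungDensity.measurable_abs_mul (hg : IsYoungDensity g) :
    Measurable fun t : ℝ => g |t| * |t| := by
  have hmono : Monotone fun t : ℝ => g (max t 0) := by
    intro a b hab
    rcases le_or_gt a 0 with ha | ha
    · simpa [max_eq_right ha, hg.zero] using hg.nonneg (le_max_right b 0)
    · have hb := ha.trans_le hab
      simpa [max_eq_left ha.le, max_eq_left hb.le] using hg.mono ha hb hab
  have habs : Measurable fun t : ℝ => |t| := continuous_abs.measurable
  have h : (fun t : ℝ => g |t|) = fun t : ℝ => g (max |t| 0) := by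
    funext t
    rw [max_eq_left (abs_nonneg t)]
  refine Measurable.mul ?_ habs
  rw [h]
  exact hmono.measurable.comp habs

theorem oddg_mul_self (g : ℝ → ℝ) (t : ℝ) : oddg g t * t = g |t| * |t| := by
  rcases eq_or_ne t 0 with rfl | ht
  · simp [oddg]
  · have h : |t| ≠ 0 := abs_ne_zero.2 ht
    have h2 : t * t = |t| * |t| := (abs_mul_abs_self t).symm
    unfold oddg
    field_simp
    rw [sq, sq, h2]

theorem GrowthCondition.pplus_nonneg (hG : GrowthCondition g pminus pplus) : 0 ≤ pplus := by
  have h := hG.2 1 one_pos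
  linarith [hG.1]

theorem GrowthCondition.mul_le (hg : IsYoungDensity g) (hG : GrowthCondition g pminus pplus)
    (t : ℝ) : g |t| * |t| ≤ pplus * primitive g |t| := by
  rcases eq_or_ne t 0 with rfl | ht
  · simp [primitive]
  · have h0 : 0 < |t| := abs_pos.2 ht
    obtain ⟨h1, h2⟩ := hG.2 _ h0
    have hpos : 0 < |t| * g |t| := mul_pos h0 (hg.pos _ h0)
    -- If `G(|t|) ≤ 0`, the growth quotient would be nonpositive (also for `G(|t|) = 0`, as `x / 0 =
    -- 0`), against `1 < p⁻`.
    have hP : 0 < primitive g |t| := by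
      by_contra hc
      have := div_nonpos_of_nonneg_of_nonpos hpos.le (not_lt.1 hc)
      linarith [hG.1]
    rw [div_le_iff₀ hP] at h2
    linarith

/-! ### Finiteness of the energies and the diagonal of the pairings -/

/-- A weighted integral of `g(|w|)|w|` is finite as soon as that of `G(|w|)` is. -/
theorem lintegral_abs_mul_lt_top {X : Type*} [MeasurableSpace X] {ν : Measure X} {w b : X → ℝ}
    (hg : IsYoungDensity g) (hG : GrowthCondition g pminus pplus) (hb : ∀ᵐ x ∂ν, 0 ≤ b x)
    (h : ∫⁻ x, ENNReal.ofReal (b x * primitive g |w x|) ∂ν < ∞) :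
    ∫⁻ x, ENNReal.ofReal (b x * (g |w x| * |w x|)) ∂ν < ∞ := by
  calc ∫⁻ x, ENNReal.ofReal (b x * (g |w x| * |w x|)) ∂ν
      ≤ ∫⁻ x, ENNReal.ofReal pplus * ENNReal.ofReal (b x * primitive g |w x|) ∂ν := by
        refine lintegral_mono_ae (hb.mono fun x hx => ?_)
        rw [← ENNReal.ofReal_mul hG.pplus_nonneg]
        refine ENNReal.ofReal_le_ofReal ?_
        have := mul_le_mul_of_nonneg_left (hG.mul_le hg (w x)) hx
        linarith
    _ = ENNReal.ofReal pplus * ∫⁻ x, ENNReal.ofReal (b x * primitive g |w x|) ∂ν :=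
        lintegral_const_mul' _ _ ENNReal.ofReal_ne_top
    _ < ∞ := ENNReal.mul_lt_top ENNReal.ofReal_lt_top h

/-- No finiteness is needed here: for an infinite integral both sides take the default value `0`. -/
theorem integral_abs_mul_eq_toReal {X : Type*} [MeasurableSpace X] {ν : Measure X} {w b : X → ℝ}
    (hg : IsYoungDensity g) (hb : ∀ᵐ x ∂ν, 0 ≤ b x) (hbm : AEMeasurable b ν)
    (hw : AEMeasurable w ν) :
    ∫ x, b x * (g |w x| * |w x|) ∂ν =
      (∫⁻ x, ENNReal.ofReal (b x * (g |w x| * |w x|)) ∂ν).toReal :=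
  integral_eq_lintegral_of_nonneg_ae
    (hb.mono fun x hx => mul_nonneg hx (hg.nonneg_abs_mul (w x)))
    (hbm.mul (hg.measurable_abs_mul.comp_aemeasurable hw)).aestronglyMeasurable

theorem aemeasurable_Ds (hu : AEMeasurable u volume) : AEMeasurable (Ds s u) (mu n) := by
  have h1 : AEMeasurable (fun z : Rn n × Rn n => u z.1) volume := hu.comp_fst
  have h2 : AEMeasurable (fun z : Rn n × Rn n => u z.2) volume := hu.comp_snd
  have h3 : AEMeasurable (fun z : Rn n × Rn n => ‖z.1 - z.2‖ ^ s) volume := by fun_prop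
  exact ((h1.sub h2).div h3).mono_ac (withDensity_absolutelyContinuous _ _)

theorem energy_lt_top (hg : IsYoungDensity g) (hG : GrowthCondition g pminus pplus)
    {R : Set (Rn n × Rn n)} (h : modularDs g s R u < ∞) : energy g s R u < ∞ := by
  simpa [energy] using lintegral_abs_mul_lt_top (b := fun _ => 1) hg hG (by simp)
    (by simpa [modularDs] using h)

theorem energyDomain_lt_top (hg : IsYoungDensity g) (hG : GrowthCondition g pminus pplus)
    (h : modular g Ω u < ∞) : energyDomain g Ω u < ∞ := by
  simpa [energyDomain] using lintegral_abs_mul_lt_top (b := fun _ => 1) hg hG (by simp)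
    (by simpa [modular] using h)

theorem energyBdry_lt_top (hg : IsYoungDensity g) (hG : GrowthCondition g pminus pplus)
    (hβ0 : ∀ᵐ x ∂(volume.restrict Ωᶜ), 0 ≤ β x)
    (h : modularBdry g Ω β u < ∞) : energyBdry g Ω β u < ∞ :=
  lintegral_abs_mul_lt_top hg hG hβ0 h

theorem pairing_self (hg : IsYoungDensity g) (hu : AEMeasurable u volume)
    (R : Set (Rn n × Rn n)) : pairing g s R u u = (energy g s R u).toReal := by
  simpa [energy, pairing, oddg_mul_self] using
    integral_abs_mul_eq_toReal (ν := (mu n).restrict R) (b := fun _ => 1) hg (by simp)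
      aemeasurable_const (aemeasurable_Ds (s := s) hu).restrict

theorem pairingDomain_self (hg : IsYoungDensity g) (hu : AEMeasurable u volume) :
    pairingDomain g Ω u u = (energyDomain g Ω u).toReal := by
  simpa [energyDomain, pairingDomain, oddg_mul_self] using
    integral_abs_mul_eq_toReal (ν := volume.restrict Ω) (b := fun _ => 1) hg (by simp)
      aemeasurable_const hu.restrict

theorem pairingBdry_self (hg : IsYoungDensity g) (hu : AEMeasurable u volume)
    (hβ : AEMeasurable β (volume.restrict Ωᶜ)) (hβ0 : ∀ᵐ x ∂(volume.restrict Ωᶜ), 0 ≤ β x) :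
    pairingBdry g Ω β u u = (energyBdry g Ω β u).toReal := by
  simpa [energyBdry, pairingBdry, oddg_mul_self, mul_assoc] using
    integral_abs_mul_eq_toReal (ν := volume.restrict Ωᶜ) hg hβ0 hβ hu.restrict

/-! ### Nonvanishing of the denominator -/

theorem ae_eq_zero_of_lintegral_eq_zero {X : Type*} [MeasurableSpace X] {ν : Measure X}
    {w : X → ℝ} (hg : IsYoungDensity g) (hw : AEMeasurable w ν)
    (h : ∫⁻ x, ENNReal.ofReal (g |w x| * |w x|) ∂ν = 0) : ∀ᵐ x ∂ν, w x = 0 := by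
  have h' := (lintegral_eq_zero_iff'
    (hg.measurable_abs_mul.comp_aemeasurable hw).ennreal_ofReal).1 h
  exact h'.mono fun x hx => hg.eq_zero_of_abs_mul_le (ENNReal.ofReal_eq_zero.1 hx)

/-- A function with zero energy on a region containing `Ω × ℝⁿ` that vanishes in `Ω` is zero. -/
theorem ae_eq_zero_of_energy_eq_zero (hg : IsYoungDensity g) (hΩo : IsOpen Ω) (hΩn : Ω.Nonempty)
    (hu : AEMeasurable u volume) {R : Set (Rn n × Rn n)} (hR : Ω ×ˢ univ ⊆ R)
    (hE : energy g s R u = 0) (hF : energyDomain g Ω u = 0) : u =ᵐ[volume] 0 := by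
  have hD : ∀ᵐ z ∂((mu n).restrict (Ω ×ˢ univ)), Ds s u z = 0 :=
    ae_mono (Measure.restrict_mono hR le_rfl)
      (ae_eq_zero_of_lintegral_eq_zero hg (aemeasurable_Ds hu).restrict hE)
  have h0 : ∀ᵐ x ∂(volume.restrict Ω), u x = 0 :=
    ae_eq_zero_of_lintegral_eq_zero hg hu.restrict hF
  have hmeas : MeasurableSet (Ω ×ˢ (univ : Set (Rn n))) :=
    hΩo.measurableSet.prod MeasurableSet.univ
  have hdens : Measurable fun z : Rn n × Rn n => ENNReal.ofReal (1 / ‖z.1 - z.2‖ ^ n) := by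
    fun_prop
  have hprod : ∀ᵐ z ∂((volume.restrict Ω).prod (volume : Measure (Rn n))), u z.1 = u z.2 := by
    rw [mu, restrict_withDensity hmeas, ae_withDensity_iff hdens, Measure.volume_eq_prod,
      ← Measure.prod_restrict, Measure.restrict_univ] at hD
    refine hD.mono fun z hz => ?_
    -- On the diagonal the claim is trivial; off it the density of `mu n` is positive, so the `mu
    -- n`-a.e. identity can be used.
    rcases eq_or_ne z.1 z.2 with he | he
    · rw [he]
    · have hn : 0 < ‖z.1 - z.2‖ := norm_pos_iff.2 (sub_ne_zero.2 he)
      have h1 : Ds s u z = 0 := hz (ENNReal.ofReal_pos.2 (by positivity)).ne'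
      have h2 : ‖z.1 - z.2‖ ^ s ≠ 0 := (Real.rpow_pos_of_pos hn s).ne'
      exact sub_eq_zero.1 ((div_eq_zero_iff.1 h1).resolve_right h2)
  -- `Ω` has positive measure, so some `x ∈ Ω` satisfies both `u x = 0` and `u x = u y` for a.e.
  -- `y`.
  have : (ae (volume.restrict Ω)).NeBot :=
    ae_restrict_neBot.2 (hΩo.measure_pos volume hΩn).ne'
  obtain ⟨x, hx0, hx⟩ := (h0.and (Measure.ae_ae_of_ae_prod hprod)).exists
  exact hx.mono fun y hy => hy.symm.trans hx0

/-! ### Eigenvalues dominate the Rayleigh infima -/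

theorem coe_div_le_of_toReal_eq_mul {E F : ℝ≥0∞} {lam : ℝ} (hE : E ≠ ∞) (hF : F ≠ ∞)
    (h : E.toReal = lam * F.toReal) (h0 : F = 0 → E ≠ 0) :
    ((E / F : ℝ≥0∞) : EReal) ≤ lam := by
  have hF0 : F ≠ 0 := by
    intro hc
    rw [hc, ENNReal.toReal_zero, mul_zero, ENNReal.toReal_eq_zero_iff] at h
    exact h0 hc (h.resolve_right hE)
  rw [← EReal.coe_ennreal_toReal (ENNReal.div_ne_top hE hF0), EReal.coe_le_coe_iff,
    ENNReal.toReal_div, h, mul_div_cancel_right₀ _ (ENNReal.toReal_pos hF0 hF).ne']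

theorem prod_univ_subset_crossRegion (Ω : Set (Rn n)) : Ω ×ˢ univ ⊆ crossRegion Ω :=
  fun _ hz hc => hc.1 hz.1

theorem barD_le_of_isDirichletEigenvalue (hg : IsYoungDensity g)
    (hG : GrowthCondition g pminus pplus) (hΩo : IsOpen Ω) (hΩn : Ω.Nonempty) {lam : ℝ}
    (h : IsDirichletEigenvalue g s Ω lam) : (barD g s Ω : EReal) ≤ lam := by
  obtain ⟨u, hu, hne, heq⟩ := h
  have ⟨hm, hI, hJ, h0⟩ := hu
  have hIΩ : modular g Ω u < ∞ :=
    (lintegral_mono' (Measure.restrict_mono (subset_univ Ω) le_rfl) le_rfl).trans_lt hI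
  have hself := heq u hu
  rw [pairing_self hg hm, pairingDomain_self hg hm] at hself
  refine (EReal.coe_ennreal_le_coe_ennreal_iff.2 (iInf₂_le u ⟨hu, hne⟩)).trans ?_
  exact coe_div_le_of_toReal_eq_mul (energy_lt_top hg hG hJ).ne
    (energyDomain_lt_top hg hG hIΩ).ne hself fun hF hE =>
      hne (ae_eq_zero_of_energy_eq_zero hg hΩo hΩn hm (subset_univ _) hE hF)

theorem barN_le_of_isNeumannEigenvalue (hg : IsYoungDensity g)
    (hG : GrowthCondition g pminus pplus) (hΩo : IsOpen Ω) (hΩn : Ω.Nonempty) {lam : ℝ}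
    (h : IsNeumannEigenvalue g s Ω lam) : (barN g s Ω : EReal) ≤ lam := by
  obtain ⟨u, hu, hne, heq⟩ := h
  have ⟨hm, hI, hJ⟩ := hu
  have hself := heq u hu
  rw [pairing_self hg hm, pairingDomain_self hg hm] at hself
  refine (EReal.coe_ennreal_le_coe_ennreal_iff.2 (iInf₂_le u ⟨hu, hne⟩)).trans ?_
  exact coe_div_le_of_toReal_eq_mul (energy_lt_top hg hG hJ).ne
    (energyDomain_lt_top hg hG hI).ne hself fun hF hE =>
      hne (ae_eq_zero_of_energy_eq_zero hg hΩo hΩn hm (prod_univ_subset_crossRegion Ω) hE hF)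

theorem barR_le_of_isRobinEigenvalue (hg : IsYoungDensity g)
    (hG : GrowthCondition g pminus pplus) (hΩo : IsOpen Ω) (hΩn : Ω.Nonempty)
    (hβ : AEMeasurable β (volume.restrict Ωᶜ)) (hβ0 : ∀ᵐ x ∂(volume.restrict Ωᶜ), 0 ≤ β x)
    {lam : ℝ} (h : IsRobinEigenvalue g s Ω β lam) : (barR g s Ω β : EReal) ≤ lam := by
  obtain ⟨u, hu, hne, heq⟩ := h
  have ⟨hm, hI, hJ, hB⟩ := hu
  have hEJ := (energy_lt_top hg hG hJ).ne
  have hEB := (energyBdry_lt_top hg hG hβ0 hB).ne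
  have hself := heq u hu
  -- Moving the boundary term to the left produces the numerator of the Robin quotient; both terms
  -- are finite, so `toReal` is additive.
  rw [pairing_self hg hm, pairingDomain_self hg hm, pairingBdry_self hg hm hβ hβ0,
    eq_sub_iff_add_eq, ← ENNReal.toReal_add hEJ hEB] at hself
  refine (EReal.coe_ennreal_le_coe_ennreal_iff.2 (iInf₂_le u ⟨hu, hne⟩)).trans ?_
  exact coe_div_le_of_toReal_eq_mul (ENNReal.add_ne_top.2 ⟨hEJ, hEB⟩)
    (energyDomain_lt_top hg hG hI).ne hself fun hF hE =>
      hne (ae_eq_zero_of_energy_eq_zero hg hΩo hΩn hm (prod_univ_subset_crossRegion Ω)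
        (add_eq_zero.1 hE).1 hF)

theorem le_hatInf {M : ℝ → ℝ → Prop} {α₀ : ℝ} {b : EReal}
    (h : ∀ α lam, M α lam → b ≤ (lam : EReal)) : b ≤ hatInf M α₀ :=
  le_iInf₂ fun α _ => le_iInf₂ fun lam hlam => h α lam hlam

end GLap

theorem mainTheorem7 (n : ℕ) (hn : 0 < n) (s : ℝ) (hs : s ∈ Set.Ioo (0 : ℝ) 1)
    (g : ℝ → ℝ) (hg : GLap.IsYoungDensity g)
    (pminus pplus : ℝ) (hG : GLap.GrowthCondition g pminus pplus)
    (Ω : Set (GLap.Rn n)) (hΩo : IsOpen Ω) (hΩb : Bornology.IsBounded Ω) (hΩn : Ω.Nonempty)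
    (β : GLap.Rn n → ℝ) (hβ : MemLp β ∞ (volume.restrict Ωᶜ))
    (hβ0 : ∀ᵐ x ∂(volume.restrict Ωᶜ), 0 ≤ β x)
    (α₀ : ℝ) (hα₀ : 0 < α₀) :
    (((GLap.barD g s Ω : ℝ≥0∞) : EReal) ≤ GLap.hatD g s Ω α₀ ∧
      ¬ ∃ lam : ℝ, GLap.IsDirichletEigenvalue g s Ω lam ∧
        (lam : EReal) < ((GLap.barD g s Ω : ℝ≥0∞) : EReal)) ∧
    (((GLap.barN g s Ω : ℝ≥0∞) : EReal) ≤ GLap.hatN g s Ω α₀ ∧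
      ¬ ∃ lam : ℝ, GLap.IsNeumannEigenvalue g s Ω lam ∧
        (lam : EReal) < ((GLap.barN g s Ω : ℝ≥0∞) : EReal)) ∧
    (((GLap.barR g s Ω β : ℝ≥0∞) : EReal) ≤ GLap.hatR g s Ω β α₀ ∧
      ¬ ∃ lam : ℝ, GLap.IsRobinEigenvalue g s Ω β lam ∧
        (lam : EReal) < ((GLap.barR g s Ω β : ℝ≥0∞) : EReal)) := by
  have hD (lam : ℝ) (h : GLap.IsDirichletEigenvalue g s Ω lam) :=
    GLap.barD_le_of_isDirichletEigenvalue hg hG hΩo hΩn h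
  have hN (lam : ℝ) (h : GLap.IsNeumannEigenvalue g s Ω lam) :=
    GLap.barN_le_of_isNeumannEigenvalue hg hG hΩo hΩn h
  have hR (lam : ℝ) (h : GLap.IsRobinEigenvalue g s Ω β lam) :=
    GLap.barR_le_of_isRobinEigenvalue hg hG hΩo hΩn hβ.aestronglyMeasurable.aemeasurable hβ0 h
  exact
    ⟨⟨GLap.le_hatInf fun _ lam ⟨u, _, hu⟩ => hD lam ⟨u, hu⟩,
      fun ⟨lam, h, hlt⟩ => (hD lam h).not_gt hlt⟩,
    ⟨GLap.le_hatInf fun _ lam ⟨u, _, hu⟩ => hN lam ⟨u, hu⟩,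
      fun ⟨lam, h, hlt⟩ => (hN lam h).not_gt hlt⟩,
    ⟨GLap.le_hatInf fun _ lam ⟨u, _, hu⟩ => hR lam ⟨u, hu⟩,
      fun ⟨lam, h, hlt⟩ => (hR lam h).not_gt hlt⟩⟩
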